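/- **Model.** Let $B,L\ge 1$ and $L\le W$ be integers, $\sigma\ge 0$, and let $\delta\in\mathbb R$ with $\delta^2\le 1$ be such that the $B\times B$ matrix $R$ with ones on the diagonal and $\delta$ off the diagonal is positive semidefinite (a correlation matrix). Let $H_0,\dots,H_{L-1}$ and $E_0,\dots,E_{W-1}$ be random complex $B\times U$ matrices all of whose entries are jointly independent, the entries of each $H_\ell$ being $\mathcal{CN}(0,1/(BL))$ and those of each $E_\omega$ being $\mathcal{CN}(0,1)$ (circularly symmetric). For subcarriers $\omega\in\{0,\dots,W-1\}$ put $$\mathbf H_\omega=\sum_{\ell=0}^{L-1}R^{1/2}H_\ell\, e^{-j2\pi\omega\ell/W}+\sigma E_\omega,\qquad \mathbf G_\omega=\mathbf H_\omega^H\mathbf H_\omega .$$ Let $\Omega\subseteq\{0,\dots,W-1\}$ be the set of active subcarriers and $\mathcal P=\{p_0<\dots<p_{|\mathcal P|-1}\}\subseteq\Omega$ a nonempty set of base points. The 0th-order interpolation is $\widetilde{\mathbf G}_\omega=\mathbf G_\omega$ for $\omega\in\mathcal P$, and $\widetilde{\mathbf G}_\omega=\mathbf G_p$ for $\omega\in\Omega\setminus\mathcal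 P$, where $p\in\mathcal P$ minimizes $|p-\omega|$ (ties broken arbitrarily). For an entry $(m,n)$ let $\mathrm{MSE}_\omega=\mathbb E\big[|[\widetilde{\mathbf G}_\omega]_{m,n}-[\mathbf G_\omega]_{m,n}|^2\big]$. Put $\varepsilon_{\mathrm{CSI}}=2\sigma^2(2+B\sigma^2)$, $\varepsilon_{\mathrm{cor}}=\delta^2(B-1)$, and $f_L(\phi)=L^{-2}\frac{1-\cos L\phi}{1-\cos\phi}$, with $f_L(\phi)=1$ for $\phi\in2\pi\mathbb Z$ (continuous extension). **Claim.** Let $d_{\max}=\max_{\omega\in\Omega}\min_{p\in\mathcal P}|p-\omega|$. Then, for every entry $(m,n)$, all the expectations $\mathrm{MSE}_\omega$, $\omega\in\Omega$, are finite and $$\max_{\omega\in\Omega}\mathrm{MSE}_\omega\le\begin{cases}\varepsilon_{\mathrm{CSI}}+\frac2B(1+\varepsilon_{\mathrm{cor}}), & d_{\max}\ge W/L,\\[2pt] \varepsilon_{\mathrm{CSI}}+\frac{2(1+\varepsilon_{\mathrm{cor}})}B\Big(1-f_L\big(\tfrac{2\pi}{W}d_{\max}\big)\Big), & d_{\max}<W/L.\end{cases}$$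 If every $\omega\in\Omega$ satisfies $\min\mathcal P\le\omega\le\max\mathcal P$, then the same bound also holds with $d_{\max}=\max_{0\le k\le|\mathcal P|-2}\big\lfloor\frac{p_{k+1}-p_k}{2}\big\rfloor$ (read as $0$ if $|\mathcal P|=1$). -/

import Mathlib

open MeasureTheory ProbabilityTheory
open scoped MatrixOrder ComplexOrder NNReal

noncomputable section

namespace GramInterp

/-- The circularly-symmetric complex Gaussian distribution `CN(0, v)` on `ℂ`: real and imaginary
parts are independent real Gaussians with mean `0` and variance `v / 2` each. -/
def complexGaussian (v : ℝ≥0) : Measure ℂ :=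
  ((gaussianReal 0 (v / 2)).prod (gaussianReal 0 (v / 2))).map
    Complex.measurableEquivRealProd.symm

/-- The scaled Fejér kernel `f_L(φ) = L⁻² (1 - cos (L φ)) / (1 - cos φ)`, with its continuous
extension `1` at the removable singularities `φ ∈ 2πℤ`. -/
def fejer (L : ℕ) (φ : ℝ) : ℝ :=
  if Real.cos φ = 1 then 1
  else ((L : ℝ) ^ 2)⁻¹ * ((1 - Real.cos (L * φ)) / (1 - Real.cos φ))

/-- The receive correlation matrix: ones on the diagonal and `δ` off the diagonal. -/
def corrMatrix (B : ℕ) (δ : ℝ) : Matrix (Fin B) (Fin B) ℂ :=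
  Matrix.of fun b b' => if b = b' then 1 else (δ : ℂ)

/-- The positive semidefinite square root `R^{1/2}` of the correlation matrix. -/
def corrSqrt (B : ℕ) (δ : ℝ) : Matrix (Fin B) (Fin B) ℂ :=
  CFC.sqrt (corrMatrix B δ)

/-- The frequency-domain channel matrix on subcarrier `ω`,
`∑ ℓ < L, R^{1/2} H_ℓ exp (-j 2π ω ℓ / W) + σ E_ω`, for given uncorrelated time-domain
matrices `H_ℓ` and estimation errors `E_ω`. -/
def freqChannel {B U W L : ℕ} (δ σ : ℝ) (H : Fin L → Matrix (Fin B) (Fin U) ℂ)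
    (E : Fin W → Matrix (Fin B) (Fin U) ℂ) (ω : Fin W) : Matrix (Fin B) (Fin U) ℂ :=
  (∑ ℓ : Fin L,
      Complex.exp (-(Complex.I * 2 * Real.pi * (ω : ℕ) * (ℓ : ℕ) / W)) •
        (corrSqrt B δ * H ℓ))
    + (σ : ℂ) • E ω

/-- The Gram matrix `G_ω = H_ωᴴ H_ω`. -/
def gram {B U W L : ℕ} (δ σ : ℝ) (H : Fin L → Matrix (Fin B) (Fin U) ℂ)
    (E : Fin W → Matrix (Fin B) (Fin U) ℂ) (ω : Fin W) : Matrix (Fin U) (Fin U) ℂ :=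
  (freqChannel δ σ H E ω).conjTranspose * freqChannel δ σ H E ω

/-- The distance `|p - ω|` between two subcarrier indices. -/
def subDist {W : ℕ} (p ω : Fin W) : ℕ := (((p : ℕ) : ℤ) - ((ω : ℕ) : ℤ)).natAbs

/-- `q` assigns to every active subcarrier outside the base-point set `P` a nearest base point
(ties may be broken in any way). -/
def IsNearest {W : ℕ} (act P : Finset (Fin W)) (q : Fin W → Fin W) : Prop :=
  ∀ ω ∈ act \ P, q ω ∈ P ∧ ∀ p ∈ P, subDist (q ω) ω ≤ subDist p ω

/-- The Gram matrices of 0th order interpolation: computed exactly on the base points `P`, and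
copied from the base point `q ω` on any other subcarrier `ω`. -/
def gramInterp {B U W L : ℕ} (δ σ : ℝ) (P : Finset (Fin W)) (q : Fin W → Fin W)
    (H : Fin L → Matrix (Fin B) (Fin U) ℂ) (E : Fin W → Matrix (Fin B) (Fin U) ℂ)
    (ω : Fin W) : Matrix (Fin U) (Fin U) ℂ :=
  if ω ∈ P then gram δ σ H E ω else gram δ σ H E (q ω)

/-- The squared error of 0th order interpolation in the entry `(m, n)` on subcarrier `ω`. -/
def sqErr {B U W L : ℕ} (δ σ : ℝ) (P : Finset (Fin W)) (q : Fin W → Fin W)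
    (H : Fin L → Matrix (Fin B) (Fin U) ℂ) (E : Fin W → Matrix (Fin B) (Fin U) ℂ)
    (m n : Fin U) (ω : Fin W) : ℝ :=
  ‖gramInterp δ σ P q H E ω m n - gram δ σ H E ω m n‖ ^ 2

/-- The mean-squared error of 0th order interpolation, for random `H` and `E`. -/
def mse {B U W L : ℕ} {S : Type*} [MeasurableSpace S] (μ : Measure S) (δ σ : ℝ)
    (P : Finset (Fin W)) (q : Fin W → Fin W)
    (H : S → Fin L → Matrix (Fin B) (Fin U) ℂ) (E : S → Fin W → Matrix (Fin B) (Fin U) ℂ)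
    (m n : Fin U) (ω : Fin W) : ℝ :=
  ∫ s, sqErr δ σ P q (H s) (E s) m n ω ∂μ

/-- All entries of the time-domain matrices (left) and of the error matrices (right), as one
family of complex random variables. -/
def entries {B U W L : ℕ} {S : Type*}
    (H : S → Fin L → Matrix (Fin B) (Fin U) ℂ) (E : S → Fin W → Matrix (Fin B) (Fin U) ℂ) :
    (Fin L × Fin B × Fin U) ⊕ (Fin W × Fin B × Fin U) → S → ℂ
  | Sum.inl i => fun s => H s i.1 i.2.1 i.2.2
  | Sum.inr i => fun s => E s i.1 i.2.1 i.2.2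

/-- The maximum over the active subcarriers of the distance to the nearest base point. -/
def maxDist {W : ℕ} (act P : Finset (Fin W)) (hP : P.Nonempty) : ℕ :=
  act.sup fun ω => P.inf' hP fun p => subDist p ω

/-- `max_k ⌊(p_{k+1} - p_k) / 2⌋`, where `p_0 < p_1 < ⋯` are the elements of `P`
(it is `0` if `P` has only one element). -/
def halfGap {W : ℕ} (P : Finset (Fin W)) : ℕ :=
  Finset.univ.sup fun k : Fin (P.card - 1) =>
    ((P.orderEmbOfFin rfl ⟨k + 1, by omega⟩ : ℕ) - (P.orderEmbOfFin rfl ⟨k, by omega⟩ : ℕ)) / 2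

/-- `ε_CSI = 2 σ² (2 + B σ²)`. -/
def epsCSI (B : ℕ) (σ : ℝ) : ℝ := 2 * σ ^ 2 * (2 + B * σ ^ 2)

/-- `ε_cor = δ² (B - 1)`. -/
def epsCor (B : ℕ) (δ : ℝ) : ℝ := δ ^ 2 * ((B : ℝ) - 1)

/-- The upper bound on the worst-case mean-squared error for maximum distance `d`. -/
def mseBound (B W L : ℕ) (δ σ : ℝ) (d : ℕ) : ℝ :=
  if (W : ℝ) / L ≤ d then epsCSI B σ + 2 / B * (1 + epsCor B δ)
  else epsCSI B σ + 2 * (1 + epsCor B δ) / B * (1 - fejer L (2 * Real.pi / W * d))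

end GramInterp

end

/-! Every entry of the channel is a linear form in independent circularly-symmetric Gaussians, so
Isserlis' theorem (`integral_linForm_four`) reduces the correlation of two Gram entries to
covariances of channel entries. Pairing within each Gram entry gives a product of means that is the
same for all subcarriers and cancels in the squared difference. The cross pairing leaves a geometric
sum of phases whose squared modulus is a Fejér kernel. Hence `integral_norm_gram_sub_gram_sq`: for
two distinct subcarriers at distance `d` the error is exactly `ε_CSI + 2 (1 + ε_cor) / B * (1 - f_L
(2π d / W))`.

What remains is to replace `d` by a larger distance. The kernel decreases on `[0, 2π / L]`
(`fejer_antitone`), which settles `d_max < W / L`; otherwise nonnegativity of the kernel suffices.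
The half-gap version is deterministic: a subcarrier between consecutive base points is within half
the gap, rounded down, of one of them (`exists_subDist_le_halfGap`). -/

namespace GramInterp

/-! ### Moments of real and circularly-symmetric complex Gaussians. -/

section Moments

lemma integrable_pow_gaussianReal (v : ℝ≥0) (k : ℕ) :
    Integrable (fun x : ℝ => x ^ k) (gaussianReal 0 v) := by
  have h := (memLp_id_gaussianReal (μ := 0) (v := v) k).integrable_norm_pow'
  refine h.mono' (by fun_prop) (Filter.Eventually.of_forall fun x => ?_)
  simp

lemma integral_sq_gaussianReal (v : ℝ≥0) : ∫ x, x ^ 2 ∂gaussianReal 0 v = v := by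
  have h := variance_fun_id_gaussianReal (μ := 0) (v := v)
  rw [variance_eq_integral (by fun_prop)] at h
  simpa [integral_id_gaussianReal] using h

/-- For independent copies `X`, `Y`, the sum `X + Y` has the law of `√2 X`. Comparing fourth moments
gives `2 M + 6 v² = 4 M`, where `M` is the fourth moment of `X`. -/
lemma integral_pow_four_gaussianReal (v : ℝ≥0) :
    ∫ x, x ^ 4 ∂gaussianReal 0 v = 3 * (v : ℝ) ^ 2 := by
  set γ := gaussianReal 0 v with hγ
  have hsum : (γ.prod γ).map (fun p => p.1 + p.2) = γ.map (fun x => √2 * x) := by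
    have h1 : HasLaw (Prod.fst : ℝ × ℝ → ℝ) (gaussianReal 0 v) (γ.prod γ) :=
      ⟨by fun_prop, by simp [hγ]⟩
    have h2 : HasLaw (Prod.snd : ℝ × ℝ → ℝ) (gaussianReal 0 v) (γ.prod γ) :=
      ⟨by fun_prop, by simp [hγ]⟩
    have hind : IndepFun (Prod.fst : ℝ × ℝ → ℝ) Prod.snd (γ.prod γ) :=
      indepFun_prod (X := id) (Y := id) measurable_id measurable_id
    have h3 := gaussianReal_add_gaussianReal_of_indepFun hind h1.map_eq h2.map_eq
    have h4 : (γ.prod γ).map (fun p => p.1 + p.2) = gaussianReal (0 + 0) (v + v) := h3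
    rw [h4, hγ, gaussianReal_map_const_mul]
    congr 1
    · simp
    · ext
      simp
      ring
  have hint := congrArg (fun ν => ∫ x, x ^ 4 ∂ν) hsum
  rw [integral_map (by fun_prop) (by fun_prop), integral_map (by fun_prop) (by fun_prop)] at hint
  have hI : ∀ a b : ℕ, Integrable (fun p : ℝ × ℝ => p.1 ^ a * p.2 ^ b) (γ.prod γ) := fun a b =>
    (integrable_pow_gaussianReal v a).mul_prod (integrable_pow_gaussianReal v b)
  have hE : ∀ a b : ℕ, ∫ p : ℝ × ℝ, p.1 ^ a * p.2 ^ b ∂(γ.prod γ)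
      = (∫ x, x ^ a ∂γ) * ∫ x, x ^ b ∂γ := fun a b =>
    integral_prod_mul (fun x : ℝ => x ^ a) (fun x : ℝ => x ^ b)
  have hexp : ∀ p : ℝ × ℝ, (p.1 + p.2) ^ 4 = p.1 ^ 4 * p.2 ^ 0 + 4 * (p.1 ^ 3 * p.2 ^ 1)
      + 6 * (p.1 ^ 2 * p.2 ^ 2) + 4 * (p.1 ^ 1 * p.2 ^ 3) + p.1 ^ 0 * p.2 ^ 4 := fun p => by ring
  have h4 : (√2 : ℝ) ^ 4 = 4 := by
    rw [show (√2 : ℝ) ^ 4 = (√2 ^ 2) ^ 2 by ring, Real.sq_sqrt (by norm_num)]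
    norm_num
  simp_rw [hexp, mul_pow, h4] at hint
  rw [integral_add (by fun_prop) (hI _ _), integral_add (by fun_prop) ((hI _ _).const_mul _),
    integral_add (by fun_prop) ((hI _ _).const_mul _),
    integral_add (hI _ _) ((hI _ _).const_mul _)] at hint
  simp only [integral_const_mul, hE] at hint
  have h1 : ∫ x, x ^ 1 ∂γ = 0 := by simp [hγ, integral_id_gaussianReal]
  rw [h1, integral_sq_gaussianReal] at hint
  simp at hint
  linarith

instance isProbabilityMeasure_complexGaussian (v : ℝ≥0) :
    IsProbabilityMeasure (complexGaussian v) := by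
  unfold complexGaussian
  exact Measure.isProbabilityMeasure_map (MeasurableEquiv.measurable _).aemeasurable

lemma integral_complexGaussian {F : Type*} [NormedAddCommGroup F] [NormedSpace ℝ F]
    (v : ℝ≥0) (f : ℂ → F) :
    ∫ z, f z ∂complexGaussian v = ∫ p : ℝ × ℝ, f ⟨p.1, p.2⟩
      ∂((gaussianReal 0 (v / 2)).prod (gaussianReal 0 (v / 2))) := by
  unfold complexGaussian
  rw [integral_map_equiv]
  rfl

lemma integrable_normSq_pow_complexGaussian (v : ℝ≥0) (k : ℕ) :
    Integrable (fun z : ℂ => (Complex.normSq z) ^ k) (complexGaussian v) := by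
  unfold complexGaussian
  rw [integrable_map_equiv]
  have : ((fun z : ℂ => (Complex.normSq z) ^ k) ∘ Complex.measurableEquivRealProd.symm)
      = fun p : ℝ × ℝ => ∑ i ∈ Finset.range (k + 1),
        (p.1 ^ (2 * i) * p.2 ^ (2 * (k - i))) * (k.choose i : ℝ) := by
    ext p
    have : Complex.normSq (Complex.measurableEquivRealProd.symm p) = p.1 ^ 2 + p.2 ^ 2 := by
      rw [Complex.normSq_apply]
      simp [Complex.measurableEquivRealProd]
      ring
    simp only [Function.comp_apply, this, add_pow, ← pow_mul]
  rw [this]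
  refine integrable_finsetSum _ fun i _ => Integrable.mul_const ?_ _
  exact (integrable_pow_gaussianReal _ _).mul_prod (integrable_pow_gaussianReal _ _)

lemma memLp_id_complexGaussian (v : ℝ≥0) : MemLp (fun z : ℂ => z) 4 (complexGaussian v) := by
  have h := integrable_normSq_pow_complexGaussian v 2
  rw [← memLp_norm_iff (by fun_prop)]
  rw [← integrable_norm_rpow_iff (by fun_prop) (by norm_num) (by norm_num)]
  convert h using 2 with z
  rw [Complex.normSq_eq_norm_sq, norm_norm]
  simp only [ENNReal.toReal_ofNat]
  rw [← pow_mul]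
  exact_mod_cast Real.rpow_natCast _ 4

lemma integral_normSq_complexGaussian (v : ℝ≥0) :
    ∫ z, Complex.normSq z ∂complexGaussian v = v := by
  rw [integral_complexGaussian]
  set γ := gaussianReal 0 (v / 2) with hγ
  have hI : ∀ a b : ℕ, Integrable (fun p : ℝ × ℝ => p.1 ^ a * p.2 ^ b) (γ.prod γ) := fun a b =>
    (integrable_pow_gaussianReal _ a).mul_prod (integrable_pow_gaussianReal _ b)
  have hE : ∀ a b : ℕ, ∫ p : ℝ × ℝ, p.1 ^ a * p.2 ^ b ∂(γ.prod γ)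
      = (∫ x, x ^ a ∂γ) * ∫ x, x ^ b ∂γ := fun a b =>
    integral_prod_mul (fun x : ℝ => x ^ a) (fun x : ℝ => x ^ b)
  have : ∀ p : ℝ × ℝ, Complex.normSq ⟨p.1, p.2⟩ = p.1 ^ 2 * p.2 ^ 0 + p.1 ^ 0 * p.2 ^ 2 := fun p => by
    simp [Complex.normSq_apply]; ring
  simp_rw [this]
  rw [integral_add (hI _ _) (hI _ _), hE, hE, integral_sq_gaussianReal]
  simp

lemma integral_normSq_sq_complexGaussian (v : ℝ≥0) :
    ∫ z, Complex.normSq z ^ 2 ∂complexGaussian v = 2 * (v : ℝ) ^ 2 := by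
  rw [integral_complexGaussian]
  set γ := gaussianReal 0 (v / 2) with hγ
  have hI : ∀ a b : ℕ, Integrable (fun p : ℝ × ℝ => p.1 ^ a * p.2 ^ b) (γ.prod γ) := fun a b =>
    (integrable_pow_gaussianReal _ a).mul_prod (integrable_pow_gaussianReal _ b)
  have hE : ∀ a b : ℕ, ∫ p : ℝ × ℝ, p.1 ^ a * p.2 ^ b ∂(γ.prod γ)
      = (∫ x, x ^ a ∂γ) * ∫ x, x ^ b ∂γ := fun a b =>
    integral_prod_mul (fun x : ℝ => x ^ a) (fun x : ℝ => x ^ b)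
  have : ∀ p : ℝ × ℝ, Complex.normSq ⟨p.1, p.2⟩ ^ 2
      = p.1 ^ 4 * p.2 ^ 0 + 2 * (p.1 ^ 2 * p.2 ^ 2) + p.1 ^ 0 * p.2 ^ 4 := fun p => by
    simp [Complex.normSq_apply]; ring
  simp_rw [this]
  rw [integral_add (by fun_prop) (hI _ _), integral_add (hI _ _) ((hI _ _).const_mul _),
    integral_const_mul, hE, hE, hE, integral_sq_gaussianReal, integral_pow_four_gaussianReal]
  simp
  ring

/-- A quarter turn is a swap of the coordinates and one sign change. This much circular symmetry is
enough to kill the unbalanced moments of low order. -/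
lemma complexGaussian_map_I_mul (v : ℝ≥0) :
    (complexGaussian v).map (fun z => Complex.I * z) = complexGaussian v := by
  unfold complexGaussian
  set γ := gaussianReal 0 (v / 2) with hγ
  have hneg : γ.map (fun x => -x) = γ := by rw [hγ, gaussianReal_map_neg, neg_zero]
  have hrot : (γ.prod γ).map (fun p : ℝ × ℝ => (-p.2, p.1)) = γ.prod γ := by
    have h1 : (γ.prod γ).map (Prod.map (fun x => -x) id) = γ.prod γ := by
      rw [← Measure.map_prod_map γ γ (by fun_prop) measurable_id, hneg, Measure.map_id]
    conv_rhs => rw [← h1, ← Measure.prod_swap, Measure.map_map (by fun_prop) (by fun_prop)]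
    rfl
  rw [Measure.map_map (by fun_prop) (MeasurableEquiv.measurable _)]
  conv_rhs => rw [← hrot, Measure.map_map (MeasurableEquiv.measurable _) (by fun_prop)]
  congr 1
  ext p
  apply Complex.ext <;> simp [Complex.measurableEquivRealProd]

open ComplexConjugate in
/-- The mixed moments of a circularly-symmetric complex Gaussian with `a` factors `z` and `b`
factors `conj z`, up to order two in each. -/
lemma integral_pow_mul_conj_pow_complexGaussian (v : ℝ≥0) {a b : ℕ} (ha : a ≤ 2) (hb : b ≤ 2) :
    ∫ z, z ^ a * conj z ^ b ∂complexGaussian v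
      = if a = b then (a.factorial : ℂ) * (v : ℂ) ^ a else 0 := by
  split_ifs with hab
  · subst hab
    have : ∀ z : ℂ, z ^ a * conj z ^ a = ((Complex.normSq z ^ a : ℝ) : ℂ) := fun z => by
      rw [← mul_pow, Complex.mul_conj]; push_cast; rfl
    simp_rw [this]
    rw [integral_complex_ofReal]
    interval_cases a
    · simp
    · simp [integral_normSq_complexGaussian]
    · rw [integral_normSq_sq_complexGaussian]; simp
  · have h := congrArg (fun ν => ∫ z, z ^ a * conj z ^ b ∂ν) (complexGaussian_map_I_mul v)
    rw [integral_map (by fun_prop) (by fun_prop)] at h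
    have : ∀ z : ℂ, (Complex.I * z) ^ a * conj (Complex.I * z) ^ b
        = (Complex.I ^ a * (-Complex.I) ^ b) * (z ^ a * conj z ^ b) := fun z => by
      rw [map_mul, Complex.conj_I]; ring
    simp_rw [this] at h
    rw [integral_const_mul] at h
    -- The factor is `I ^ (a - b)`, and `a - b` is one of `±1`, `±2`, hence not a multiple of four.
    have hne : Complex.I ^ a * (-Complex.I) ^ b ≠ 1 := by
      interval_cases a <;> interval_cases b <;>
        first
        | exact absurd rfl hab
        | (intro h; simp [Complex.ext_iff, pow_two] at h; try norm_num at h)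
    have h' : (Complex.I ^ a * (-Complex.I) ^ b - 1) * ∫ z, z ^ a * conj z ^ b ∂complexGaussian v
        = 0 := by
      rw [sub_mul, h]; ring
    exact (mul_eq_zero.mp h').resolve_left (sub_ne_zero.mpr hne)

end Moments

end GramInterp

namespace GramInterp

/-! ### Fourth moments of linear forms in independent complex Gaussians. -/

section Isserlis

open ComplexConjugate

variable {S : Type*} [MeasurableSpace S] {μ : Measure S}

lemma memLp_conj {f : S → ℂ} {p : ENNReal} (hf : MemLp f p μ) :
    MemLp (fun s => conj (f s)) p μ :=
  hf.star

/-- Hölder twice: products of two `L⁴` functions are in `L²`, and products of two of those are in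
`L¹`. -/
lemma integrable_conj_mul_conj_mul {f g h k : S → ℂ} (hf : MemLp f 4 μ) (hg : MemLp g 4 μ)
    (hh : MemLp h 4 μ) (hk : MemLp k 4 μ) :
    Integrable (fun s => (conj (f s) * g s) * (conj (h s) * k s)) μ := by
  have : ENNReal.HolderTriple 4 4 2 := ⟨by
    rw [← two_mul, show (4 : ENNReal) = 2 * 2 by norm_num,
      ENNReal.mul_inv (by simp) (by simp), ← mul_assoc, ENNReal.mul_inv_cancel (by simp) (by simp),
      one_mul]⟩
  have h1 : MemLp (fun s => conj (f s) * g s) 2 μ := hg.mul (memLp_conj hf)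
  have h2 : MemLp (fun s => conj (h s) * k s) 2 μ := hk.mul (memLp_conj hh)
  exact h1.integrable_mul h2

variable {ι : Type*} [Fintype ι]

/-- The linear form `∑ i, a i * Z i` in the random variables `Z i`. -/
noncomputable def linForm (Z : ι → S → ℂ) (a : ι → ℂ) (s : S) : ℂ := ∑ i, a i * Z i s

/-- The covariance `∑ i, conj (a i) * b i * v i` of two linear forms in independent circularly
symmetric variables of variances `v i`. -/
noncomputable def formCov (v : ι → ℝ≥0) (a b : ι → ℂ) : ℂ := ∑ i, conj (a i) * b i * (v i : ℝ)

variable {Z : ι → S → ℂ} {v : ι → ℝ≥0}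

lemma memLp_of_hasLaw_complexGaussian {X : S → ℂ} {w : ℝ≥0}
    (hX : HasLaw X (complexGaussian w) μ) : MemLp X 4 μ := by
  have h := memLp_id_complexGaussian w
  rw [← hX.map_eq, memLp_map_measure_iff (by fun_prop) hX.aemeasurable] at h
  exact h

lemma memLp_linForm (hZ : ∀ i, HasLaw (Z i) (complexGaussian (v i)) μ) (a : ι → ℂ) :
    MemLp (linForm Z a) 4 μ :=
  memLp_finsetSum _ fun i _ => (memLp_of_hasLaw_complexGaussian (hZ i)).const_mul (a i)

/-- The fourth moments of independent circularly-symmetric complex Gaussians. -/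
lemma integral_conj_mul_conj_mul_of_iIndepFun [DecidableEq ι]
    (hZ : ∀ i, HasLaw (Z i) (complexGaussian (v i)) μ) (hind : iIndepFun Z μ) (i j k l : ι) :
    ∫ s, (conj (Z i s) * Z j s) * (conj (Z k s) * Z l s) ∂μ
      = (if i = j ∧ k = l then ((v i : ℝ) : ℂ) * (v k : ℝ) else 0)
        + (if i = l ∧ k = j then ((v i : ℝ) : ℂ) * (v k : ℝ) else 0) := by
  -- `a t` and `b t` count the plain and the conjugated occurrences of `Z t`; by independence the
  -- expectation factors over `t`, and only `a = b` contributes.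
  set a : ι → ℕ := fun t => (if j = t then 1 else 0) + (if l = t then 1 else 0) with ha
  set b : ι → ℕ := fun t => (if i = t then 1 else 0) + (if k = t then 1 else 0) with hb
  have hprod : ∀ (w : ι → ℂ) (p q : ι),
      ∏ t, w t ^ ((if p = t then 1 else 0) + (if q = t then 1 else 0)) = w p * w q := by
    intro w p q
    simp only [pow_add, Finset.prod_mul_distrib, pow_ite, pow_one, pow_zero,
      Finset.prod_ite_eq, Finset.mem_univ, if_true]
  have ha2 : ∀ t, a t ≤ 2 := fun t => by simp only [ha]; split_ifs <;> simp
  have hb2 : ∀ t, b t ≤ 2 := fun t => by simp only [hb]; split_ifs <;> simp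
  have h1 : ∀ s, (conj (Z i s) * Z j s) * (conj (Z k s) * Z l s)
      = ∏ t, (fun z : ℂ => z ^ a t * conj z ^ b t) (Z t s) := fun s => by
    simp only [Finset.prod_mul_distrib]
    rw [hprod (fun t => Z t s), hprod (fun t => conj (Z t s))]
    ring
  simp_rw [h1]
  rw [hind.integral_fun_prod_comp (fun t => (hZ t).aemeasurable)
    (f := fun t z => z ^ a t * conj z ^ b t) (fun t => by fun_prop)]
  have h2 : ∀ t, ∫ s, Z t s ^ a t * conj (Z t s) ^ b t ∂μ
      = if a t = b t then ((a t).factorial : ℂ) * (v t : ℂ) ^ a t else 0 := fun t => by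
    rw [← integral_pow_mul_conj_pow_complexGaussian (v t) (ha2 t) (hb2 t), ← (hZ t).map_eq,
      integral_map (hZ t).aemeasurable (by fun_prop)]
  simp_rw [h2]
  by_cases hab : ∀ t, a t = b t
  · simp only [hab, if_true, Finset.prod_mul_distrib]
    rw [hprod (fun t => ((v t : ℝ) : ℂ))]
    -- The value `2` at `i = k` accounts for both pairings holding at once on the right-hand side.
    have hf : ∏ t, ((b t).factorial : ℂ) = if i = k then 2 else 1 := by
      split_ifs with hik
      · subst hik
        rw [Finset.prod_eq_single i]
        · simp [hb]
        · intro t _ hti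
          simp [hb, Ne.symm hti]
        · simp
      · refine Finset.prod_eq_one fun t _ => ?_
        have : b t ≤ 1 := by simp only [hb]; split_ifs <;> simp_all
        interval_cases b t <;> simp
    rw [hf]
    have hi := hab i
    have hk := hab k
    simp only [ha, hb] at hi hk
    by_cases hik : i = k
    · subst hik
      have : j = i ∧ l = i := by
        by_contra hcon
        split_ifs at hi <;> simp_all
      obtain ⟨rfl, rfl⟩ := this
      simp
      ring
    · by_cases hij : i = j
      · subst hij
        have hkl : k = l := by
          by_contra hcon
          have : l ≠ k := Ne.symm hcon
          simp_all
        subst hkl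
        simp [hik]
      · have hji : j ≠ i := Ne.symm hij
        have hki : k ≠ i := Ne.symm hik
        have hil : l = i := by
          by_contra hcon
          simp_all
        subst hil
        have hkj : j = k := by
          by_contra hcon
          simp_all
        subst hkj
        simp [hik]
  · have hn : ¬ (i = j ∧ k = l) := by
      rintro ⟨rfl, rfl⟩
      exact hab fun t => rfl
    have hn' : ¬ (i = l ∧ k = j) := by
      rintro ⟨rfl, rfl⟩
      exact hab fun t => add_comm _ _
    rw [if_neg hn, if_neg hn', add_zero]
    push Not at hab
    obtain ⟨t, ht⟩ := hab
    exact Finset.prod_eq_zero (Finset.mem_univ t) (if_neg ht)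

/-- Isserlis' theorem for fourth moments of linear forms in independent circularly-symmetric
complex Gaussians. -/
lemma integral_linForm_four (hZ : ∀ i, HasLaw (Z i) (complexGaussian (v i)) μ)
    (hind : iIndepFun Z μ) (a b c d : ι → ℂ) :
    ∫ s, (conj (linForm Z a s) * linForm Z b s) * (conj (linForm Z c s) * linForm Z d s) ∂μ
      = formCov v a b * formCov v c d + formCov v a d * formCov v c b := by
  classical
  have hexp : ∀ s, (conj (linForm Z a s) * linForm Z b s) *
      (conj (linForm Z c s) * linForm Z d s)
      = ∑ i, ∑ j, ∑ k, ∑ l, (conj (a i) * b j * (conj (c k) * d l)) *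
        ((conj (Z i s) * Z j s) * (conj (Z k s) * Z l s)) := fun s => by
    simp only [linForm, map_sum, Finset.sum_mul_sum, map_mul]
    refine Finset.sum_congr rfl fun i _ => ?_
    rw [Finset.sum_comm]
    refine Finset.sum_congr rfl fun j _ => ?_
    refine Finset.sum_congr rfl fun k _ => ?_
    refine Finset.sum_congr rfl fun l _ => ?_
    ring
  have hm := fun i => memLp_of_hasLaw_complexGaussian (hZ i)
  have hI : ∀ i j k l, Integrable (fun s => (conj (a i) * b j * (conj (c k) * d l)) *
        ((conj (Z i s) * Z j s) * (conj (Z k s) * Z l s))) μ := fun i j k l =>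
    (integrable_conj_mul_conj_mul (hm i) (hm j) (hm k) (hm l)).const_mul _
  simp_rw [hexp]
  rw [integral_finsetSum _ fun i _ => integrable_finsetSum _ fun j _ =>
    integrable_finsetSum _ fun k _ => integrable_finsetSum _ fun l _ => hI i j k l]
  have : ∀ i, ∫ s, ∑ j, ∑ k, ∑ l, (conj (a i) * b j * (conj (c k) * d l)) *
        ((conj (Z i s) * Z j s) * (conj (Z k s) * Z l s)) ∂μ
      = ∑ k, (conj (a i) * b i * (v i : ℝ)) * (conj (c k) * d k * (v k : ℝ))
        + ∑ k, (conj (a i) * d i * (v i : ℝ)) * (conj (c k) * b k * (v k : ℝ)) := fun i => by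
    rw [integral_finsetSum _ fun j _ =>
      integrable_finsetSum _ fun k _ => integrable_finsetSum _ fun l _ => hI i j k l]
    have : ∀ j, ∫ s, ∑ k, ∑ l, (conj (a i) * b j * (conj (c k) * d l)) *
        ((conj (Z i s) * Z j s) * (conj (Z k s) * Z l s)) ∂μ
        = ∑ k, ∑ l, (conj (a i) * b j * (conj (c k) * d l)) *
          ((if i = j ∧ k = l then ((v i : ℝ) : ℂ) * (v k : ℝ) else 0)
        + (if i = l ∧ k = j then ((v i : ℝ) : ℂ) * (v k : ℝ) else 0)) := fun j => by
      rw [integral_finsetSum _ fun k _ => integrable_finsetSum _ fun l _ => hI i j k l]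
      refine Finset.sum_congr rfl fun k _ => ?_
      rw [integral_finsetSum _ fun l _ => hI i j k l]
      refine Finset.sum_congr rfl fun l _ => ?_
      rw [integral_const_mul, integral_conj_mul_conj_mul_of_iIndepFun hZ hind]
    simp_rw [this, mul_add, Finset.sum_add_distrib]
    congr 1
    · rw [Finset.sum_eq_single i]
      · simp only [true_and, mul_ite, mul_zero, Finset.sum_ite_eq, Finset.mem_univ, if_true]
        exact Finset.sum_congr rfl fun k _ => by ring
      · intro j _ hj
        simp [Ne.symm hj]
      · simp
    · rw [Finset.sum_comm]
      refine Finset.sum_congr rfl fun k _ => ?_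
      rw [Finset.sum_eq_single k]
      · simp only [and_true, mul_ite, mul_zero, Finset.sum_ite_eq, Finset.mem_univ, if_true]
        ring
      · intro j _ hj
        simp [Ne.symm hj]
      · simp
  simp_rw [this, Finset.sum_add_distrib]
  simp only [formCov, Finset.sum_mul_sum]

end Isserlis

end GramInterp

namespace GramInterp

/-! ### Bounds and monotonicity of the Fejér kernel. -/

section Fejer

/-- `sin (n t) / sin t`, as a polynomial in cosines. -/
noncomputable def sinRatio : ℕ → ℝ → ℝ
  | 0, _ => 0
  | n + 1, t => Real.cos t * sinRatio n t + Real.cos (n * t)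

lemma sinRatio_mul_sin (n : ℕ) (t : ℝ) : sinRatio n t * Real.sin t = Real.sin (n * t) := by
  induction n with
  | zero => simp [sinRatio]
  | succ n ih =>
    rw [sinRatio, show ((n + 1 : ℕ) : ℝ) * t = n * t + t by push_cast; ring, Real.sin_add, ← ih]
    ring

lemma sinRatio_zero_right (n : ℕ) : sinRatio n 0 = n := by
  induction n with
  | zero => simp [sinRatio]
  | succ n ih => simp [sinRatio, ih]

/-- In the recursion `cos t * sinRatio n t + cos (n t)` both cosines decrease, and the product of
decreasing factors decreases once they are nonnegative. Nonnegativity of the ratio is read off from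
`sin (n t) ≥ 0`. -/
lemma sinRatio_nonneg_and_antitone (n : ℕ) {s t : ℝ} (hs : 0 ≤ s) (hst : s ≤ t)
    (ht : n * t ≤ Real.pi) : 0 ≤ sinRatio n t ∧ sinRatio n t ≤ sinRatio n s := by
  induction n with
  | zero => simp [sinRatio]
  | succ n ih =>
    rcases Nat.eq_zero_or_pos n with rfl | hn
    · simp [sinRatio]
    have hn' : (1 : ℝ) ≤ n := by exact_mod_cast hn
    have ht0 : 0 ≤ t := hs.trans hst
    push_cast at ht
    -- Since `n ≥ 1`, `2 t ≤ (n + 1) t ≤ π`; this makes `cos s` nonnegative.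
    have ht2 : t ≤ Real.pi / 2 := by nlinarith
    have hnt : n * t ≤ Real.pi := by nlinarith
    have hns : n * s ≤ n * t := by gcongr
    have hpi := Real.pi_pos
    obtain ⟨h0, h1⟩ := ih hnt
    constructor
    · rcases ht0.eq_or_lt with h | h
      · rw [← h, sinRatio_zero_right]; positivity
      · have hsin : 0 < Real.sin t := Real.sin_pos_of_pos_of_lt_pi h (by linarith)
        have hmul := sinRatio_mul_sin (n + 1) t
        have hnn : 0 ≤ Real.sin ((n + 1 : ℕ) * t) :=
          Real.sin_nonneg_of_nonneg_of_le_pi (by positivity) (by push_cast; exact ht)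
        rw [← hmul] at hnn
        exact nonneg_of_mul_nonneg_left hnn hsin
    · have hc : Real.cos t ≤ Real.cos s :=
        Real.cos_le_cos_of_nonneg_of_le_pi hs (by linarith) hst
      have hcn : Real.cos (n * t) ≤ Real.cos (n * s) :=
        Real.cos_le_cos_of_nonneg_of_le_pi (by positivity) hnt hns
      have hcs : 0 ≤ Real.cos s := Real.cos_nonneg_of_mem_Icc ⟨by linarith, by linarith⟩
      exact add_le_add (mul_le_mul hc h1 h0 hcs) hcn

lemma fejer_neg (L : ℕ) (φ : ℝ) : fejer L (-φ) = fejer L φ := by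
  simp [fejer]

lemma normSq_exp_I_mul_sub_one (φ : ℝ) :
    Complex.normSq (Complex.exp (Complex.I * φ) - 1) = 2 * (1 - Real.cos φ) := by
  rw [mul_comm, Complex.exp_mul_I, ← Complex.ofReal_cos, ← Complex.ofReal_sin,
    Complex.normSq_apply]
  simp [-Complex.ofReal_cos, -Complex.ofReal_sin]
  nlinarith [Real.sin_sq_add_cos_sq φ]

/-- The squared modulus of a geometric sum of phases is a rescaled Fejér kernel. -/
lemma normSq_sum_exp (L : ℕ) (hL : 0 < L) (φ : ℝ) :
    Complex.normSq (∑ ℓ ∈ Finset.range L, Complex.exp (Complex.I * φ * ℓ))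
      = (L : ℝ) ^ 2 * fejer L φ := by
  have hL' : (L : ℝ) ≠ 0 := by positivity
  have hpow : ∀ ℓ : ℕ, Complex.exp (Complex.I * φ * ℓ) = Complex.exp (Complex.I * φ) ^ ℓ :=
    fun ℓ => by rw [mul_comm, Complex.exp_nat_mul]
  simp_rw [hpow]
  have hz := normSq_exp_I_mul_sub_one φ
  unfold fejer
  split_ifs with h
  · rw [h, sub_self, mul_zero, Complex.normSq_eq_zero, sub_eq_zero] at hz
    simp [hz, pow_two]
  · have hden : (1 - Real.cos φ) ≠ 0 := sub_ne_zero.mpr (Ne.symm h)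
    have hgeom := congrArg Complex.normSq (geom_sum_mul (Complex.exp (Complex.I * φ)) L)
    rw [map_mul, hz, ← hpow, mul_assoc, mul_comm (φ : ℂ)] at hgeom
    have hLz := normSq_exp_I_mul_sub_one (L * φ)
    push_cast at hLz
    rw [hLz] at hgeom
    field_simp
    linarith

lemma fejer_nonneg (L : ℕ) (φ : ℝ) : 0 ≤ fejer L φ := by
  unfold fejer
  split_ifs
  · exact zero_le_one
  · have h1 := Real.cos_le_one φ
    have h2 := Real.cos_le_one (L * φ)
    exact mul_nonneg (by positivity) (div_nonneg (by linarith) (by linarith))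

lemma fejer_le_one (L : ℕ) (hL : 0 < L) (φ : ℝ) : fejer L φ ≤ 1 := by
  have h := normSq_sum_exp L hL φ
  have hn : ‖∑ ℓ ∈ Finset.range L, Complex.exp (Complex.I * φ * ℓ)‖ ≤ L := by
    refine (norm_sum_le _ _).trans ?_
    have : ∀ ℓ : ℕ, ‖Complex.exp (Complex.I * φ * ℓ)‖ = 1 := fun ℓ => by
      rw [show Complex.I * φ * ℓ = ((φ * ℓ : ℝ) : ℂ) * Complex.I by push_cast; ring,
        Complex.norm_exp_ofReal_mul_I]
    simp [this]
  rw [Complex.normSq_eq_norm_sq] at h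
  have hL' : (0 : ℝ) < (L : ℝ) ^ 2 := by positivity
  have h2 : (L : ℝ) ^ 2 * fejer L φ ≤ (L : ℝ) ^ 2 * 1 := by
    rw [← h, mul_one]
    gcongr
  exact le_of_mul_le_mul_left h2 hL'

lemma fejer_one (φ : ℝ) : fejer 1 φ = 1 := by
  unfold fejer
  split_ifs with h
  · rfl
  · have hden : (1 - Real.cos φ) ≠ 0 := sub_ne_zero.mpr (Ne.symm h)
    simp [div_self hden]

lemma fejer_two_mul (L : ℕ) {t : ℝ} (ht : Real.sin t ≠ 0) :
    fejer L (2 * t) = ((L : ℝ) ^ 2)⁻¹ * sinRatio L t ^ 2 := by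
  have hd : ∀ x : ℝ, 1 - Real.cos (2 * x) = 2 * Real.sin x ^ 2 := fun x => by
    rw [Real.cos_two_mul, Real.cos_sq']; ring
  have h1 := hd t
  have h2 := hd (L * t)
  have hne : Real.cos (2 * t) ≠ 1 := fun h => by
    rw [h, sub_self] at h1
    exact ht (by simpa using h1.symm)
  rw [fejer, if_neg hne, h1, show (L : ℝ) * (2 * t) = 2 * (L * t) by ring, h2,
    ← sinRatio_mul_sin]
  field_simp

/-- The Fejér kernel decreases on `[0, 2π / L]`. -/
lemma fejer_antitone (L : ℕ) (hL : 0 < L) {x y : ℝ} (hx : 0 ≤ x) (hxy : x ≤ y)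
    (hy : y * L ≤ 2 * Real.pi) : fejer L y ≤ fejer L x := by
  -- `L = 1` is separate because `y` may then reach `2π`, where `sin (y / 2)` vanishes; `x = 0` is
  -- separate for the same reason. Otherwise the kernel is a rescaled square of `sinRatio`.
  rcases (Nat.succ_le_of_lt hL).eq_or_lt with h | h
  · rw [← h, fejer_one, fejer_one]
  rcases hx.eq_or_lt with h0 | h0
  · rw [← h0]
    exact (fejer_le_one L hL y).trans (by simp [fejer])
  have hL2 : (2 : ℝ) ≤ L := by exact_mod_cast h
  have hpi := Real.pi_pos
  have hy' : y ≤ Real.pi := by nlinarith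
  have hsx : 0 < Real.sin (x / 2) := Real.sin_pos_of_pos_of_lt_pi (by linarith) (by linarith)
  have hsy : 0 < Real.sin (y / 2) := Real.sin_pos_of_pos_of_lt_pi (by linarith) (by linarith)
  have key := sinRatio_nonneg_and_antitone L (s := x / 2) (t := y / 2) (by linarith)
    (by linarith) (by linarith)
  have e1 := fejer_two_mul L hsx.ne'
  have e2 := fejer_two_mul L hsy.ne'
  rw [mul_div_cancel₀ _ (two_ne_zero)] at e1 e2
  rw [e1, e2]
  gcongr
  · exact key.1
  · exact key.2

end Fejer

end GramInterp

namespace GramInterp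

/-! ### Distances to the nearest base point. -/

section Combinatorics

variable {W : ℕ}

lemma subDist_comm (p ω : Fin W) : subDist p ω = subDist ω p := by
  unfold subDist; omega

lemma subDist_le_maxDist {act P : Finset (Fin W)} (hP : P.Nonempty) {ω p : Fin W} (hω : ω ∈ act)
    (hp : ∀ p' ∈ P, subDist p ω ≤ subDist p' ω) : subDist p ω ≤ maxDist act P hP :=
  (Finset.le_inf' hP (fun p => subDist p ω) hp).trans
    (Finset.le_sup (f := fun ω => P.inf' hP fun p => subDist p ω) hω)

lemma half_gap_le_halfGap (P : Finset (Fin W)) (k : ℕ) (hk : k + 1 < P.card) :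
    ((P.orderEmbOfFin rfl ⟨k + 1, hk⟩ : ℕ) - (P.orderEmbOfFin rfl ⟨k, by omega⟩ : ℕ)) / 2
      ≤ halfGap P :=
  Finset.le_sup (f := fun k : Fin (P.card - 1) =>
    ((P.orderEmbOfFin rfl ⟨k + 1, by omega⟩ : ℕ) - (P.orderEmbOfFin rfl ⟨k, by omega⟩ : ℕ)) / 2)
    (Finset.mem_univ (⟨k, by omega⟩ : Fin (P.card - 1)))

lemma exists_subDist_le_halfGap {P : Finset (Fin W)} (hP : P.Nonempty) {ω : Fin W} (hω : ω ∉ P)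
    (hmin : P.min' hP ≤ ω) (hmax : ω ≤ P.max' hP) : ∃ p ∈ P, subDist p ω ≤ halfGap P := by
  have hgap := half_gap_le_halfGap P
  have hmem := P.orderEmbOfFin_mem rfl
  have hrange : ∀ p ∈ P, ∃ k, P.orderEmbOfFin rfl k = p := fun p hp => by
    have : p ∈ Set.range (P.orderEmbOfFin rfl) := by rw [Finset.range_orderEmbOfFin]; exact hp
    exact this
  generalize P.orderEmbOfFin rfl = e at hgap hmem hrange
  -- The left neighbour of `ω` is the largest base point below it. Its successor in `P` exists
  -- because `ω < max P`, and lies beyond `ω` by maximality.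
  have hne : (P.filter (· ≤ ω)).Nonempty :=
    ⟨_, Finset.mem_filter.mpr ⟨P.min'_mem hP, hmin⟩⟩
  obtain ⟨haP, haω⟩ := Finset.mem_filter.mp ((P.filter (· ≤ ω)).max'_mem hne)
  have hamax := (P.filter (· ≤ ω)).le_max'
  obtain ⟨⟨k, hk0⟩, hk⟩ := hrange _ haP
  obtain ⟨j, hj⟩ := hrange _ (P.max'_mem hP)
  have hmax' : ω < P.max' hP :=
    lt_of_le_of_ne hmax fun h => hω (h ▸ P.max'_mem hP)
  have hkj : ⟨k, hk0⟩ < j := by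
    rw [← e.lt_iff_lt, hk, hj]
    exact haω.trans_lt hmax'
  have hk1 : k + 1 < P.card := lt_of_le_of_lt hkj j.2
  have hsucc : ω < e ⟨k + 1, hk1⟩ := by
    by_contra hcon
    have hle := hamax (e ⟨k + 1, hk1⟩) (Finset.mem_filter.mpr ⟨hmem _, not_lt.mp hcon⟩)
    rw [← hk, e.le_iff_le, Fin.mk_le_mk] at hle
    omega
  rw [← hk] at haω
  have h1 : (e ⟨k, hk0⟩ : ℕ) ≤ ω := haω
  have h2 : (ω : ℕ) < e ⟨k + 1, hk1⟩ := hsucc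
  have h3 := hgap k hk1
  -- The two distances add up to the gap, so they cannot both exceed its half rounded down.
  by_cases hc : subDist (e ⟨k, hk0⟩) ω ≤ halfGap P
  · exact ⟨_, hmem _, hc⟩
  · refine ⟨e ⟨k + 1, hk1⟩, hmem _, ?_⟩
    unfold subDist at hc ⊢
    generalize (e ⟨k, hk0⟩ : ℕ) = x at *
    generalize (e ⟨k + 1, hk1⟩ : ℕ) = y at *
    generalize halfGap P = g at *
    omega

end Combinatorics

end GramInterp

namespace GramInterp

/-! ### Second-order statistics of the channel and of its Gram matrices. -/

section Channel

open ComplexConjugate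

/-- The subcarrier phase `exp (-j 2π ω ℓ / W)`. -/
noncomputable def phase {W L : ℕ} (ω : Fin W) (ℓ : Fin L) : ℂ :=
  Complex.exp (-(Complex.I * 2 * Real.pi * (ω : ℕ) * (ℓ : ℕ) / W))

/-- The variances of the family `entries H E`. -/
noncomputable def entryVar (B L U W : ℕ) : (Fin L × Fin B × Fin U) ⊕ (Fin W × Fin B × Fin U) → ℝ≥0 :=
  Sum.elim (fun _ => 1 / ((B : ℝ≥0) * (L : ℝ≥0))) (fun _ => 1)

/-- The coefficients of the entry `(b, m)` of `freqChannel` on subcarrier `ω` as a linear form in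
`entries H E`. -/
noncomputable def channelCoeff {B L U W : ℕ} (δ σ : ℝ) (ω : Fin W) (b : Fin B) (m : Fin U) :
    (Fin L × Fin B × Fin U) ⊕ (Fin W × Fin B × Fin U) → ℂ :=
  Sum.elim (fun i => if i.2.2 = m then phase ω i.1 * corrSqrt B δ b i.2.1 else 0)
    (fun i => if i = (ω, b, m) then (σ : ℂ) else 0)

variable {B U W L : ℕ} {S : Type*}

lemma freqChannel_apply (δ σ : ℝ) (H : S → Fin L → Matrix (Fin B) (Fin U) ℂ)
    (E : S → Fin W → Matrix (Fin B) (Fin U) ℂ) (s : S) (ω : Fin W) (b : Fin B) (m : Fin U) :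
    freqChannel δ σ (H s) (E s) ω b m = linForm (entries H E) (channelCoeff δ σ ω b m) s := by
  simp only [freqChannel, linForm, Fintype.sum_sum_type, channelCoeff, Sum.elim_inl,
    Sum.elim_inr, entries, ite_mul, zero_mul, Finset.sum_ite_eq', Finset.mem_univ, if_true,
    Matrix.add_apply, Matrix.smul_apply, smul_eq_mul, Matrix.sum_apply, Matrix.mul_apply,
    Fintype.sum_prod_type]
  congr 1
  refine Finset.sum_congr rfl fun ℓ _ => ?_
  rw [Finset.mul_sum]
  exact Finset.sum_congr rfl fun b' _ => (mul_assoc _ _ _).symm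

/-- The square root is Hermitian, so the conjugate transposes the first factor and the sum is an
entry of the square of `corrSqrt B δ`. -/
lemma conj_corrSqrt_mul_corrSqrt {δ : ℝ} (hR : (corrMatrix B δ).PosSemidef) (b b' : Fin B) :
    ∑ c, conj (corrSqrt B δ b c) * corrSqrt B δ b' c = corrMatrix B δ b' b := by
  have hmul : corrSqrt B δ * corrSqrt B δ = corrMatrix B δ :=
    CFC.sqrt_mul_sqrt_self _ (Matrix.nonneg_iff_posSemidef.mpr hR)
  have hherm : (corrSqrt B δ).IsHermitian :=
    (Matrix.nonneg_iff_posSemidef.mp (CFC.sqrt_nonneg (corrMatrix B δ))).isHermitian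
  rw [← hmul, Matrix.mul_apply]
  refine Finset.sum_congr rfl fun c _ => ?_
  rw [mul_comm]
  congr 1
  exact hherm.apply c b

/-- The covariance, over the rows `b` and `b'`, of a column of the channel on two subcarriers. -/
noncomputable def channelCov (B L : ℕ) {W : ℕ} (δ σ : ℝ) (ω ω' : Fin W) (b b' : Fin B) : ℂ :=
  ((B : ℂ) * L)⁻¹ * (∑ ℓ : Fin L, conj (phase ω ℓ) * phase ω' ℓ) * corrMatrix B δ b' b
    + if ω = ω' ∧ b = b' then (σ : ℂ) ^ 2 else 0

/-- Different columns involve disjoint sets of variables. Within a column, the taps contribute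
through `R` and the phases, the errors only when subcarrier and row agree. -/
lemma formCov_channelCoeff {δ : ℝ} (σ : ℝ) (hR : (corrMatrix B δ).PosSemidef) (ω ω' : Fin W)
    (b b' : Fin B) (m n : Fin U) :
    formCov (entryVar B L U W) (channelCoeff δ σ ω b m) (channelCoeff δ σ ω' b' n)
      = if m = n then channelCov B L δ σ ω ω' b b' else 0 := by
  rw [formCov, Fintype.sum_sum_type]
  simp only [channelCoeff, entryVar, Sum.elim_inl, Sum.elim_inr]
  have hE : ∑ i : Fin W × Fin B × Fin U, conj (if i = (ω, b, m) then (σ : ℂ) else 0) *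
      (if i = (ω', b', n) then (σ : ℂ) else 0) * (((1 : ℝ≥0) : ℝ) : ℂ)
      = if m = n then (if ω = ω' ∧ b = b' then (σ : ℂ) ^ 2 else 0) else 0 := by
    rw [Finset.sum_eq_single (ω, b, m)]
    · by_cases h1 : m = n <;> by_cases h2 : ω = ω' <;> by_cases h3 : b = b' <;>
        simp [h1, h2, h3, pow_two]
    · intro i _ hi
      simp [hi]
    · simp
  have hH : ∑ i : Fin L × Fin B × Fin U,
      conj (if i.2.2 = m then phase ω i.1 * corrSqrt B δ b i.2.1 else 0) *
      (if i.2.2 = n then phase ω' i.1 * corrSqrt B δ b' i.2.1 else 0) *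
        (((1 / ((B : ℝ≥0) * (L : ℝ≥0)) : ℝ≥0) : ℝ) : ℂ)
      = if m = n then ((B : ℂ) * L)⁻¹ * (∑ ℓ : Fin L, conj (phase ω ℓ) * phase ω' ℓ) *
        corrMatrix B δ b' b else 0 := by
    simp only [Fintype.sum_prod_type]
    have h1 : ∀ (ℓ : Fin L) (c : Fin B), ∑ u : Fin U,
        conj (if u = m then phase ω ℓ * corrSqrt B δ b c else 0) *
        (if u = n then phase ω' ℓ * corrSqrt B δ b' c else 0) *
          (((1 / ((B : ℝ≥0) * (L : ℝ≥0)) : ℝ≥0) : ℝ) : ℂ)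
        = if m = n then ((B : ℂ) * L)⁻¹ * (conj (phase ω ℓ) * phase ω' ℓ) *
          (conj (corrSqrt B δ b c) * corrSqrt B δ b' c) else 0 := fun ℓ c => by
      rw [Finset.sum_eq_single m]
      · by_cases h : m = n
        · simp [h]; ring
        · simp [h]
      · intro i _ hi
        simp [hi]
      · simp
    simp_rw [h1]
    split_ifs
    · simp_rw [← Finset.mul_sum, conj_corrSqrt_mul_corrSqrt hR, ← Finset.sum_mul,
        ← Finset.mul_sum]
    · simp
  rw [hE, hH]
  split_ifs <;> simp [channelCov, *]

lemma gram_apply (δ σ : ℝ) (H : S → Fin L → Matrix (Fin B) (Fin U) ℂ)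
    (E : S → Fin W → Matrix (Fin B) (Fin U) ℂ) (s : S) (ω : Fin W) (m n : Fin U) :
    gram δ σ (H s) (E s) ω m n = ∑ b, conj (linForm (entries H E) (channelCoeff δ σ ω b m) s) *
      linForm (entries H E) (channelCoeff δ σ ω b n) s := by
  simp only [gram, Matrix.mul_apply, Matrix.conjTranspose_apply, freqChannel_apply,
    RCLike.star_def]

/-- Conjugating a Gram entry swaps `m` and `n`, which puts the product in the alternating form that
`integral_linForm_four` expects. -/
lemma gram_mul_conj_gram (δ σ : ℝ) (H : S → Fin L → Matrix (Fin B) (Fin U) ℂ)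
    (E : S → Fin W → Matrix (Fin B) (Fin U) ℂ) (s : S) (α β : Fin W) (m n : Fin U) :
    gram δ σ (H s) (E s) α m n * conj (gram δ σ (H s) (E s) β m n)
      = ∑ b, ∑ b', (conj (linForm (entries H E) (channelCoeff δ σ α b m) s) *
          linForm (entries H E) (channelCoeff δ σ α b n) s) *
        (conj (linForm (entries H E) (channelCoeff δ σ β b' n) s) *
          linForm (entries H E) (channelCoeff δ σ β b' m) s) := by
  rw [gram_apply, gram_apply, map_sum, Finset.sum_mul_sum]
  refine Finset.sum_congr rfl fun b _ => Finset.sum_congr rfl fun b' _ => ?_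
  rw [map_mul, Complex.conj_conj]
  ring

variable [MeasurableSpace S] {μ : Measure S}
  {H : S → Fin L → Matrix (Fin B) (Fin U) ℂ} {E : S → Fin W → Matrix (Fin B) (Fin U) ℂ}

lemma hasLaw_entries
    (hH : ∀ ℓ b u, HasLaw (fun s => H s ℓ b u)
      (complexGaussian (1 / ((B : ℝ≥0) * (L : ℝ≥0)))) μ)
    (hE : ∀ ω b u, HasLaw (fun s => E s ω b u) (complexGaussian 1) μ) :
    ∀ i, HasLaw (entries H E i) (complexGaussian (entryVar B L U W i)) μ
  | Sum.inl i => hH i.1 i.2.1 i.2.2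
  | Sum.inr i => hE i.1 i.2.1 i.2.2

lemma integrable_gram_mul_conj_gram (δ σ : ℝ)
    (hlaw : ∀ i, HasLaw (entries H E i) (complexGaussian (entryVar B L U W i)) μ)
    (α β : Fin W) (m n : Fin U) :
    Integrable (fun s => gram δ σ (H s) (E s) α m n * conj (gram δ σ (H s) (E s) β m n)) μ := by
  simp_rw [gram_mul_conj_gram]
  exact integrable_finsetSum _ fun b _ => integrable_finsetSum _ fun b' _ =>
    integrable_conj_mul_conj_mul (memLp_linForm hlaw _) (memLp_linForm hlaw _)
      (memLp_linForm hlaw _) (memLp_linForm hlaw _)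

/-- The first term is the product of the two means, from pairing inside each Gram entry; the second,
from the cross pairing, does not depend on `m` and `n`. -/
lemma integral_gram_mul_conj_gram {δ : ℝ} (σ : ℝ) (hR : (corrMatrix B δ).PosSemidef)
    (hlaw : ∀ i, HasLaw (entries H E i) (complexGaussian (entryVar B L U W i)) μ)
    (hindep : iIndepFun (entries H E) μ) (α β : Fin W) (m n : Fin U) :
    ∫ s, gram δ σ (H s) (E s) α m n * conj (gram δ σ (H s) (E s) β m n) ∂μ
      = (if m = n then (∑ b, channelCov B L δ σ α α b b) * ∑ b, channelCov B L δ σ β β b b else 0)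
        + ∑ b, ∑ b', channelCov B L δ σ α β b b' * channelCov B L δ σ β α b' b := by
  have hI : ∀ b b', Integrable (fun s =>
      (conj (linForm (entries H E) (channelCoeff δ σ α b m) s) *
          linForm (entries H E) (channelCoeff δ σ α b n) s) *
        (conj (linForm (entries H E) (channelCoeff δ σ β b' n) s) *
          linForm (entries H E) (channelCoeff δ σ β b' m) s)) μ := fun b b' =>
    integrable_conj_mul_conj_mul (memLp_linForm hlaw _) (memLp_linForm hlaw _)
      (memLp_linForm hlaw _) (memLp_linForm hlaw _)
  simp_rw [gram_mul_conj_gram]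
  rw [integral_finsetSum _ fun b _ => integrable_finsetSum _ fun b' _ => hI b b']
  simp_rw [fun b => integral_finsetSum Finset.univ fun b' _ => hI b b',
    integral_linForm_four hlaw hindep, formCov_channelCoeff σ hR, Finset.sum_add_distrib]
  congr 1
  · by_cases h : m = n
    · simp [h, Finset.sum_mul_sum]
    · simp [h]

end Channel

end GramInterp

namespace GramInterp

/-! ### The exact interpolation error and its bound. -/

section Error

open ComplexConjugate

variable {B U W L : ℕ}

lemma conj_phase_mul_phase (α β : Fin W) (ℓ : Fin L) :
    conj (phase α ℓ) * phase β ℓ = Complex.exp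
      (Complex.I * ((2 * Real.pi / W * (((α : ℕ) : ℝ) - ((β : ℕ) : ℝ)) : ℝ) : ℂ) * (ℓ : ℕ)) := by
  rw [phase, phase, ← Complex.exp_conj, ← Complex.exp_add]
  congr 1
  simp only [map_neg, map_div₀, map_mul, Complex.conj_I, Complex.conj_ofReal, map_natCast,
    map_ofNat]
  push_cast
  ring

/-- The phases depend only on `α - β`, and evenness of the kernel lets the distance replace the
signed difference. -/
lemma normSq_sum_conj_phase_mul_phase (hL : 0 < L) (α β : Fin W) :
    Complex.normSq (∑ ℓ : Fin L, conj (phase α ℓ) * phase β ℓ)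
      = (L : ℝ) ^ 2 * fejer L (2 * Real.pi / W * (subDist α β : ℕ)) := by
  simp_rw [conj_phase_mul_phase]
  rw [Fin.sum_univ_eq_sum_range (fun ℓ => Complex.exp (Complex.I *
    ((2 * Real.pi / W * (((α : ℕ) : ℝ) - ((β : ℕ) : ℝ)) : ℝ) : ℂ) * (ℓ : ℕ))) L,
    normSq_sum_exp L hL]
  congr 1
  have hd : ((subDist α β : ℕ) : ℝ) = |((α : ℕ) : ℝ) - ((β : ℕ) : ℝ)| := by
    unfold subDist
    rw [Nat.cast_natAbs]
    push_cast
    rfl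
  rw [hd]
  rcases abs_choice (((α : ℕ) : ℝ) - ((β : ℕ) : ℝ)) with h | h
  · rw [h]
  · rw [h, mul_neg, fejer_neg]

lemma sum_conj_phase_mul_phase_self (α : Fin W) :
    ∑ ℓ : Fin L, conj (phase α ℓ) * phase α ℓ = L := by
  simp [conj_phase_mul_phase]

lemma sum_sum_ite_eq (x y : ℂ) :
    ∑ b : Fin B, ∑ b' : Fin B, (if b = b' then x else y) = B * (x + (B - 1) * y) := by
  have : ∀ b b' : Fin B, (if b = b' then x else y) = (if b = b' then x - y else 0) + y :=
    fun b b' => by split_ifs <;> ring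
  simp_rw [this, Finset.sum_add_distrib]
  simp
  ring

lemma channelCov_self (hL : 0 < L) (δ σ : ℝ) (α : Fin W) (b b' : Fin B) :
    channelCov B L δ σ α α b b' = if b = b' then (B : ℂ)⁻¹ + (σ : ℂ) ^ 2 else (B : ℂ)⁻¹ * δ := by
  have hL' : (L : ℂ) ≠ 0 := by exact_mod_cast hL.ne'
  rw [channelCov, sum_conj_phase_mul_phase_self, mul_inv, mul_assoc (B : ℂ)⁻¹,
    inv_mul_cancel₀ hL', mul_one]
  by_cases h : b = b'
  · simp [h, corrMatrix]
  · simp [h, Ne.symm h, corrMatrix]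

lemma sum_channelCov_self_mul (hL : 0 < L) (δ σ : ℝ) (α : Fin W) :
    ∑ b, ∑ b', channelCov B L δ σ α α b b' * channelCov B L δ σ α α b' b
      = B * (((B : ℂ)⁻¹ + (σ : ℂ) ^ 2) ^ 2 + (B - 1) * ((B : ℂ)⁻¹ * δ) ^ 2) := by
  rw [← sum_sum_ite_eq]
  refine Finset.sum_congr rfl fun b _ => Finset.sum_congr rfl fun b' _ => ?_
  rw [channelCov_self hL, channelCov_self hL]
  by_cases h : b = b'
  · simp [h, pow_two]
  · simp [h, Ne.symm h, pow_two]

/-- On distinct subcarriers the estimation errors are uncorrelated, so `σ` disappears. The two phase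
sums are conjugate and multiply to `L²` times the kernel. -/
lemma sum_channelCov_mul_of_ne (hL : 0 < L) (δ σ : ℝ) {α β : Fin W} (hαβ : α ≠ β) :
    ∑ b, ∑ b', channelCov B L δ σ α β b b' * channelCov B L δ σ β α b' b
      = B * ((B : ℂ)⁻¹ ^ 2 * fejer L (2 * Real.pi / W * (subDist α β : ℕ)) +
        (B - 1) * ((B : ℂ)⁻¹ ^ 2 * fejer L (2 * Real.pi / W * (subDist α β : ℕ)) * δ ^ 2)) := by
  have hL' : (L : ℂ) ≠ 0 := by exact_mod_cast hL.ne'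
  have hconj : ∑ ℓ : Fin L, conj (phase β ℓ) * phase α ℓ
      = conj (∑ ℓ : Fin L, conj (phase α ℓ) * phase β ℓ) := by
    rw [map_sum]
    refine Finset.sum_congr rfl fun ℓ _ => ?_
    rw [map_mul, Complex.conj_conj, mul_comm]
  have hsq := normSq_sum_conj_phase_mul_phase hL α β
  have hsq' := Complex.mul_conj (∑ ℓ : Fin L, conj (phase α ℓ) * phase β ℓ)
  rw [hsq] at hsq'
  push_cast at hsq'
  rw [← sum_sum_ite_eq]
  refine Finset.sum_congr rfl fun b _ => Finset.sum_congr rfl fun b' _ => ?_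
  simp only [channelCov, hαβ, Ne.symm hαβ, false_and, if_false, add_zero, hconj]
  have hR : corrMatrix B δ b' b * corrMatrix B δ b b' = if b = b' then 1 else (δ : ℂ) ^ 2 := by
    by_cases h : b = b'
    · simp [h, corrMatrix]
    · simp [h, Ne.symm h, corrMatrix, pow_two]
  calc _ = (B : ℂ)⁻¹ ^ 2 * (L : ℂ)⁻¹ ^ 2 * ((∑ ℓ : Fin L, conj (phase α ℓ) * phase β ℓ) *
        conj (∑ ℓ : Fin L, conj (phase α ℓ) * phase β ℓ)) *
        (corrMatrix B δ b' b * corrMatrix B δ b b') := by rw [mul_inv]; ring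
    _ = _ := by
      rw [hsq', hR]
      split_ifs <;> field_simp

variable {S : Type*} [MeasurableSpace S] {μ : Measure S}
  {H : S → Fin L → Matrix (Fin B) (Fin U) ℂ} {E : S → Fin W → Matrix (Fin B) (Fin U) ℂ}

lemma ofReal_norm_sub_sq (x y : ℂ) :
    ((‖x - y‖ ^ 2 : ℝ) : ℂ) = x * conj x - x * conj y - y * conj x + y * conj y := by
  rw [← Complex.normSq_eq_norm_sq, ← Complex.mul_conj, map_sub]
  ring

lemma integral_sub_sub_add {f g h k : S → ℂ} (hf : Integrable f μ) (hg : Integrable g μ)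
    (hh : Integrable h μ) (hk : Integrable k μ) :
    ∫ s, (f s - g s - h s + k s) ∂μ = ∫ s, f s ∂μ - ∫ s, g s ∂μ - ∫ s, h s ∂μ + ∫ s, k s ∂μ := by
  have h1 := integral_add ((hf.sub hg).sub hh) hk
  have h2 := integral_sub (hf.sub hg) hh
  have h3 := integral_sub hf hg
  simp only [Pi.sub_apply] at h1 h2 h3
  rw [h1, h2, h3]

lemma integrable_norm_gram_sub_gram_sq (δ σ : ℝ)
    (hlaw : ∀ i, HasLaw (entries H E i) (complexGaussian (entryVar B L U W i)) μ)
    (α β : Fin W) (m n : Fin U) :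
    Integrable
      (fun s => ‖gram δ σ (H s) (E s) α m n - gram δ σ (H s) (E s) β m n‖ ^ 2) μ := by
  have hI := fun α β => integrable_gram_mul_conj_gram δ σ hlaw α β m n
  have h := ((((hI α α).sub (hI α β)).sub (hI β α)).add (hI β β)).re
  refine h.congr (Filter.Eventually.of_forall fun s => ?_)
  have := ofReal_norm_sub_sq (gram δ σ (H s) (E s) α m n) (gram δ σ (H s) (E s) β m n)
  simp only [Pi.add_apply, Pi.sub_apply]
  rw [← this]
  exact Complex.ofReal_re _

/-- The mean-squared distance between the Gram matrix entries on two different subcarriers. -/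
lemma integral_norm_gram_sub_gram_sq (hB : 0 < B) (hL : 0 < L) {δ : ℝ} (σ : ℝ)
    (hR : (corrMatrix B δ).PosSemidef)
    (hlaw : ∀ i, HasLaw (entries H E i) (complexGaussian (entryVar B L U W i)) μ)
    (hindep : iIndepFun (entries H E) μ) {α β : Fin W} (hαβ : α ≠ β) (m n : Fin U) :
    ∫ s, ‖gram δ σ (H s) (E s) α m n - gram δ σ (H s) (E s) β m n‖ ^ 2 ∂μ
      = epsCSI B σ + 2 * (1 + epsCor B δ) / B *
        (1 - fejer L (2 * Real.pi / W * (subDist α β : ℕ))) := by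
  have hB' : (B : ℂ) ≠ 0 := by exact_mod_cast hB.ne'
  have hI := fun α β => integrable_gram_mul_conj_gram δ σ hlaw α β m n
  apply Complex.ofReal_injective
  rw [← integral_complex_ofReal]
  simp_rw [ofReal_norm_sub_sq]
  rw [integral_sub_sub_add (hI α α) (hI α β) (hI β α) (hI β β)]
  simp_rw [integral_gram_mul_conj_gram σ hR hlaw hindep]
  -- All four products of means equal `(1 + B σ²)²` when `m = n` and are absent otherwise, so they
  -- cancel. Each self term is `(1 + ε_cor) / B + ε_CSI / 2`, each cross term `(1 + ε_cor) / B`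
  -- times the kernel.
  rw [sum_channelCov_self_mul hL, sum_channelCov_self_mul hL, sum_channelCov_mul_of_ne hL δ σ hαβ,
    sum_channelCov_mul_of_ne hL δ σ hαβ.symm, subDist_comm β α]
  simp only [channelCov_self hL, if_true]
  simp only [epsCSI, epsCor]
  push_cast
  field_simp
  ring

lemma epsCor_nonneg (hB : 0 < B) (δ : ℝ) : 0 ≤ epsCor B δ := by
  have : (1 : ℝ) ≤ B := by exact_mod_cast hB
  exact mul_nonneg (sq_nonneg δ) (by linarith)

lemma epsCSI_nonneg (B : ℕ) (σ : ℝ) : 0 ≤ epsCSI B σ := by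
  unfold epsCSI; positivity

lemma mseBound_nonneg (hB : 0 < B) (hL : 0 < L) (δ σ : ℝ) (d : ℕ) :
    0 ≤ mseBound B W L δ σ d := by
  have h1 := epsCor_nonneg hB δ
  have h2 := epsCSI_nonneg B σ
  have h3 := sub_nonneg.mpr (fejer_le_one L hL (2 * Real.pi / W * d))
  unfold mseBound
  split_ifs <;> positivity

lemma le_mseBound (hB : 0 < B) (hL : 0 < L) (hW : 0 < W) (δ σ : ℝ) {d D : ℕ} (hdD : d ≤ D) :
    epsCSI B σ + 2 * (1 + epsCor B δ) / B * (1 - fejer L (2 * Real.pi / W * d))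
      ≤ mseBound B W L δ σ D := by
  have h1 := epsCor_nonneg hB δ
  have hc : 0 ≤ 2 * (1 + epsCor B δ) / B := by positivity
  have hLr : (0 : ℝ) < L := by exact_mod_cast hL
  have hWr : (0 : ℝ) < W := by exact_mod_cast hW
  have hdr : (d : ℝ) ≤ D := by exact_mod_cast hdD
  unfold mseBound
  split_ifs with h
  · have hf := mul_nonneg hc (fejer_nonneg L (2 * Real.pi / W * d))
    have : 2 / (B : ℝ) * (1 + epsCor B δ) = 2 * (1 + epsCor B δ) / B := by ring
    rw [this]
    linarith
  · have hlt : (D : ℝ) * L < W := by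
      rw [not_le, lt_div_iff₀ hLr] at h
      exact h
    have hf : fejer L (2 * Real.pi / W * D) ≤ fejer L (2 * Real.pi / W * d) := by
      refine fejer_antitone L hL (by positivity) (by gcongr) ?_
      -- `D < W / L` is what keeps the angle in the range `[0, 2π / L]` where the kernel decreases.
      calc 2 * Real.pi / W * D * L = 2 * Real.pi * (D * L / W) := by ring
        _ ≤ 2 * Real.pi * 1 := by
          gcongr
          rw [div_le_one hWr]
          exact hlt.le
        _ = 2 * Real.pi := mul_one _
    gcongr

lemma integrable_sqErr (δ σ : ℝ)
    (hlaw : ∀ i, HasLaw (entries H E i) (complexGaussian (entryVar B L U W i)) μ)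
    (P : Finset (Fin W)) (q : Fin W → Fin W) (m n : Fin U) (ω : Fin W) :
    Integrable (fun s => sqErr δ σ P q (H s) (E s) m n ω) μ := by
  unfold sqErr gramInterp
  split_ifs
  · exact integrable_norm_gram_sub_gram_sq δ σ hlaw ω ω m n
  · exact integrable_norm_gram_sub_gram_sq δ σ hlaw (q ω) ω m n

lemma mse_le_mseBound (hB : 0 < B) (hL : 0 < L) {δ : ℝ} (σ : ℝ)
    (hR : (corrMatrix B δ).PosSemidef)
    (hlaw : ∀ i, HasLaw (entries H E i) (complexGaussian (entryVar B L U W i)) μ)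
    (hindep : iIndepFun (entries H E) μ) (P : Finset (Fin W)) (q : Fin W → Fin W) (m n : Fin U)
    {ω : Fin W} {D : ℕ} (hq : ω ∉ P → q ω ∈ P ∧ subDist (q ω) ω ≤ D) :
    mse μ δ σ P q H E m n ω ≤ mseBound B W L δ σ D := by
  by_cases hω : ω ∈ P
  · have : mse μ δ σ P q H E m n ω = 0 := by simp [mse, sqErr, gramInterp, hω]
    rw [this]
    exact mseBound_nonneg hB hL δ σ D
  · obtain ⟨hqP, hqD⟩ := hq hω
    -- The exact error formula needs distinct subcarriers: at equal ones its right-hand side is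
    -- `ε_CSI`, not the true error `0`.
    have hne : q ω ≠ ω := fun h => hω (h ▸ hqP)
    simp only [mse, sqErr, gramInterp, hω, if_false]
    rw [integral_norm_gram_sub_gram_sq hB hL σ hR hlaw hindep hne]
    exact le_mseBound hB hL ω.pos δ σ hqD

end Error

end GramInterp

theorem corollary2 {B U W L : ℕ} (hB : 0 < B) (hL : 0 < L) (hLW : L ≤ W)
    (δ σ : ℝ) (hδ : δ ^ 2 ≤ 1) (hR : (GramInterp.corrMatrix B δ).PosSemidef) (hσ : 0 ≤ σ)
    {S : Type*} [MeasurableSpace S] (μ : MeasureTheory.Measure S)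
    [MeasureTheory.IsProbabilityMeasure μ]
    (H : S → Fin L → Matrix (Fin B) (Fin U) ℂ) (E : S → Fin W → Matrix (Fin B) (Fin U) ℂ)
    (hH : ∀ ℓ b u, ProbabilityTheory.HasLaw (fun s => H s ℓ b u)
      (GramInterp.complexGaussian (1 / ((B : NNReal) * (L : NNReal)))) μ)
    (hE : ∀ ω b u, ProbabilityTheory.HasLaw (fun s => E s ω b u)
      (GramInterp.complexGaussian 1) μ)
    (hindep : ProbabilityTheory.iIndepFun (GramInterp.entries H E) μ)
    (act P : Finset (Fin W)) (hP : P.Nonempty) (hPact : P ⊆ act)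
    (q : Fin W → Fin W) (hq : GramInterp.IsNearest act P q) (m n : Fin U) :
    (∀ ω ∈ act, MeasureTheory.Integrable
      (fun s => GramInterp.sqErr δ σ P q (H s) (E s) m n ω) μ) ∧
    act.sup' (hP.mono hPact) (fun ω => GramInterp.mse μ δ σ P q H E m n ω)
      ≤ GramInterp.mseBound B W L δ σ (GramInterp.maxDist act P hP) ∧
    ((∀ ω ∈ act, P.min' hP ≤ ω ∧ ω ≤ P.max' hP) →
      act.sup' (hP.mono hPact) (fun ω => GramInterp.mse μ δ σ P q H E m n ω)
        ≤ GramInterp.mseBound B W L δ σ (GramInterp.halfGap P)) := by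
  have hlaw := GramInterp.hasLaw_entries hH hE
  refine ⟨fun ω _ => GramInterp.integrable_sqErr δ σ hlaw P q m n ω, ?_, fun hrange => ?_⟩
  · refine Finset.sup'_le _ _ fun ω hω =>
      GramInterp.mse_le_mseBound hB hL σ hR hlaw hindep P q m n fun hωP => ?_
    obtain ⟨h1, h2⟩ := hq ω (Finset.mem_sdiff.mpr ⟨hω, hωP⟩)
    exact ⟨h1, GramInterp.subDist_le_maxDist hP hω h2⟩
  · refine Finset.sup'_le _ _ fun ω hω =>
      GramInterp.mse_le_mseBound hB hL σ hR hlaw hindep P q m n fun hωP => ?_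
    obtain ⟨h1, h2⟩ := hq ω (Finset.mem_sdiff.mpr ⟨hω, hωP⟩)
    -- The neighbour found here need not be `q ω`, but `q ω` is at least as close.
    obtain ⟨p, hp, hpω⟩ := GramInterp.exists_subDist_le_halfGap hP hωP (hrange ω hω).1
      (hrange ω hω).2
    exact ⟨h1, (h2 p hp).trans hpω⟩
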